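/- All graphs are finite and simple. For a word $w$ over an alphabet $\Sigma$ and distinct letters $i,j\in\Sigma$, let $w_{ij}$ be the word obtained from $w$ by deleting all letters other than $i$ and $j$; the letters $i$ and $j$ alternate in $w$ if neither $ii$ nor $jj$ occurs as a block of two consecutive letters of $w_{ij}$. A graph $G$ is word-representable if there is a word $w$ over $V(G)$ such that any two distinct vertices $i,j$ are adjacent in $G$ if and only if they alternate in $w$. A graph is a comparability graph if its edges admit a transitive orientation, that is, an orientation in which $a\to b$ and $b\to c$ imply $a\to c$. A graph is semi-transitive if it admits an acyclic orientation such that for every directed path $v_1\to v_2\to\cdots\to v_k$ for which the edge $v_1\to v_k$ is present, all edges $v_i\to v_j$ with $1\le i<j\le k$ are present. A graph is minimal non-word-representable (respectively, minimal non-comparability) if it is not word-representable (respectively, not a comparability graph) but each of its proper induced subgraphs is word-representable (respectively, a comparability graph). Theorem. Let $G$ be a graph, let $x\in V(G)$ be a vertex adjacent to all other vertices of $G$, and let $H$ be the subgraph of $G$ induced by $V(G)\setminus\{x\}$. Then $G$ is minimal non-word-representable if and only if $H$ is minimal non-comparability and $H$ is semi-transitive. -/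

import Mathlib

namespace SimpleGraph

open Classical in
/-- The word `w_{ij}`: the restriction of `w` to the copies of `i` and `j`. -/
noncomputable def wordRestrict {V : Type*} (w : List V) (i j : V) : List V :=
  w.filter fun a => a = i ∨ a = j

/-- The letters `i` and `j` alternate in `w`: neither `ii` nor `jj` is a factor
(a block of consecutive letters) of `w_{ij}`. -/
def Alternate {V : Type*} (w : List V) (i j : V) : Prop :=
  ¬ [i, i] <:+: wordRestrict w i j ∧ ¬ [j, j] <:+: wordRestrict w i j

/-- A graph is word-representable if some word over its vertex set represents it. -/
def WordRepresentable {V : Type*} (G : SimpleGraph V) : Prop :=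
  ∃ w : List V, ∀ i j : V, i ≠ j → (G.Adj i j ↔ Alternate w i j)

/-- `D` is an orientation of `G`: each edge of `G` receives exactly one of its two directions,
and `D` has no other arcs. -/
structure IsOrientationOf {V : Type*} (D : Digraph V) (G : SimpleGraph V) : Prop where
  adj_iff : ∀ u v : V, G.Adj u v ↔ D.Adj u v ∨ D.Adj v u
  asymm : ∀ u v : V, D.Adj u v → ¬ D.Adj v u

/-- A comparability graph: one whose edges admit a transitive orientation. -/
def IsComparabilityGraph {V : Type*} (G : SimpleGraph V) : Prop :=
  ∃ D : Digraph V, IsOrientationOf D G ∧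
    ∀ a b c : V, D.Adj a b → D.Adj b c → D.Adj a c

/-- No directed cycles. -/
def DirectedAcyclic {V : Type*} (D : Digraph V) : Prop :=
  ∀ v : V, ¬ Relation.TransGen D.Adj v v

/-- A semi-transitive digraph: it is acyclic, and whenever `v₁ → v₂ → ⋯ → v_k` is a directed path
such that the arc `v₁ → v_k` is present, all arcs `v_i → v_j` with `i < j` are present.
A directed path is given as the list of its vertices; these are automatically distinct,
because `D` is acyclic. -/
def SemiTransitiveDigraph {V : Type*} (D : Digraph V) : Prop :=
  DirectedAcyclic D ∧
    ∀ (p : List V) (hp : p ≠ []), p.IsChain D.Adj →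
      D.Adj (p.head hp) (p.getLast hp) → p.Pairwise D.Adj

/-- A graph is semi-transitive if it admits a semi-transitive orientation. -/
def SemiTransitive {V : Type*} (G : SimpleGraph V) : Prop :=
  ∃ D : Digraph V, IsOrientationOf D G ∧ SemiTransitiveDigraph D

/-- Not word-representable, but every proper induced subgraph is word-representable. -/
def IsMinimalNonWordRepresentable {V : Type*} (G : SimpleGraph V) : Prop :=
  ¬ G.WordRepresentable ∧ ∀ S : Set V, S ≠ Set.univ → (G.induce S).WordRepresentable

/-- Not a comparability graph, but every proper induced subgraph is a comparability graph. -/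
def IsMinimalNonComparability {V : Type*} (G : SimpleGraph V) : Prop :=
  ¬ G.IsComparabilityGraph ∧ ∀ S : Set V, S ≠ Set.univ → (G.induce S).IsComparabilityGraph

end SimpleGraph

/-!
Both properties of the theorem are statements about orientations, because a finite graph is
word-representable if and only if it is semi-transitive.

* If `w` represents `G`, orient each edge from the letter that occurs first. Then `i → j` means that
  in every prefix of `w` the letter `i` occurs as often as `j` or once more (`Leads`). Along a
  directed path `v₁ → ⋯ → v_k` the counts in a prefix decrease weakly, and an arc `v₁ → v_k` bounds
  the total decrease by one, so that any two vertices of the path alternate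
  (`WordRepresentable.semiTransitive`).
* Conversely, for each vertex `v` of a graph with a semi-transitive orientation there is a word
  (`separatingWord`) that contains every letter twice, restricts to `ijij` for each arc `i → j`, and
  in which `v` does not alternate with its non-neighbours. The concatenation of these words over
  all `v` represents the graph (`SemiTransitive.wordRepresentable`).

A graph with a universal vertex `x` is semi-transitive if and only if `G - x` is a comparability
graph. A transitive orientation of `G - x` extends to `G` with `x` as a source. A semi-transitive
orientation of `G` restricts to transitive orientations of the in-neighbourhood and of the
out-neighbourhood of `x`, and reversing all arcs between the two makes the orientation of `G - x`
transitive (`SemiTransitive.isComparabilityGraph`).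

The theorem follows: a proper induced subgraph of `G` through `x` is a universal vertex over a
proper induced subgraph of `G - x`, and one that avoids `x` inherits semi-transitivity from `G - x`.
-/

namespace SimpleGraph

variable {V W : Type*}

/-! ### Alternation of two letters -/

open Classical in
theorem wordRestrict_cons (a : V) (w : List V) (i j : V) :
    wordRestrict (a :: w) i j =
      if a = i ∨ a = j then a :: wordRestrict w i j else wordRestrict w i j := by
  simp [wordRestrict, List.filter_cons]

theorem wordRestrict_comm (w : List V) (i j : V) : wordRestrict w i j = wordRestrict w j i := by
  exact List.filter_congr fun _ _ => decide_eq_decide.2 or_comm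

theorem eq_or_eq_of_mem_wordRestrict {w : List V} {i j a : V} (h : a ∈ wordRestrict w i j) :
    a = i ∨ a = j := by
  simpa using (List.mem_filter.1 h).2

/-- A word without the factors `ii` and `jj`, over the letters `i` and `j`, is one in which
consecutive letters differ. -/
theorem alternate_iff_isChain {w : List V} {i j : V} :
    Alternate w i j ↔ (wordRestrict w i j).IsChain (· ≠ ·) := by
  constructor
  · rintro ⟨hi, hj⟩
    rw [List.isChain_iff_forall_rel_of_append_cons_cons]
    intro a b l₁ l₂ h hab
    subst hab
    have ha : [a, a] <:+: wordRestrict w i j := ⟨l₁, l₂, by simp [h]⟩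
    have hm : a ∈ wordRestrict w i j := ha.subset (by simp)
    rcases eq_or_eq_of_mem_wordRestrict hm with rfl | rfl
    · exact hi ha
    · exact hj ha
  · intro h
    constructor <;> intro h' <;> simpa using h.infix h'

open Classical in
/-- In every prefix of `w` the letter `i` occurs as often as `j` or once more: `i` and `j` alternate
in `w` and `i` comes first. Both `Leads w i j` and `Leads w j i` hold exactly if neither letter
occurs. -/
def Leads (w : List V) (i j : V) : Prop :=
  ∀ u, u <+: w → u.count j ≤ u.count i ∧ u.count i ≤ u.count j + 1

theorem leads_iff_isChain {w : List V} {i j : V} (hij : i ≠ j) :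
    Leads w i j ↔ (j :: wordRestrict w i j).IsChain (· ≠ ·) := by
  classical
  induction w generalizing i j with
  | nil => simp [Leads, wordRestrict]
  | cons a w ih =>
    have key : Leads (a :: w) i j ↔ ∀ u, u <+: w →
        (a :: u).count j ≤ (a :: u).count i ∧ (a :: u).count i ≤ (a :: u).count j + 1 := by
      constructor
      · exact fun h u hu => h _ (by simpa using hu)
      · intro h u hu
        rcases List.prefix_cons_iff.1 hu with rfl | ⟨t, rfl, ht⟩
        · simp
        · exact h t ht
    by_cases hi : a = i
    · subst hi
      have h2 : Leads (a :: w) a j ↔ Leads w j a := by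
        rw [key]
        refine forall₂_congr fun u _ => ?_
        simp [hij]
        omega
      rw [h2, ih hij.symm, wordRestrict_cons, wordRestrict_comm w j a]
      simp [hij.symm]
    · by_cases hj : a = j
      · subst hj
        rw [wordRestrict_cons]
        simp only [or_true, if_true, List.isChain_cons_cons, ne_eq, not_true_eq_false, false_and,
          iff_false]
        intro h
        have := (h [a] (by simp)).1
        simp [hij.symm] at this
      · have h2 : Leads (a :: w) i j ↔ Leads w i j := by
          rw [key]
          refine forall₂_congr fun u _ => ?_
          simp [hi, hj]
        rw [h2, ih hij, wordRestrict_cons]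
        simp [hi, hj]

theorem alternate_iff_leads_or_leads {w : List V} {i j : V} (hij : i ≠ j) :
    Alternate w i j ↔ Leads w i j ∨ Leads w j i := by
  rw [alternate_iff_isChain, leads_iff_isChain hij, leads_iff_isChain hij.symm,
    wordRestrict_comm w j i]
  constructor
  · intro h
    cases hw : wordRestrict w i j with
    | nil => simp
    | cons a l =>
      rw [hw] at h
      have ha : a = i ∨ a = j := eq_or_eq_of_mem_wordRestrict (w := w) (by simp [hw])
      rcases ha with rfl | rfl
      · exact .inl (List.isChain_cons_cons.2 ⟨hij.symm, h⟩)
      · exact .inr (List.isChain_cons_cons.2 ⟨hij, h⟩)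
  · rintro (h | h) <;> exact h.tail

/-! ### Word-representable graphs are semi-transitive -/

open Classical in
/-- Orienting each edge `ij` from the letter that occurs first in a representing word is
semi-transitive: along a directed path the counts in every prefix of the word decrease weakly, and
an arc from the first to the last vertex makes them decrease by at most one in total. -/
theorem WordRepresentable.semiTransitive {G : SimpleGraph V} (hG : G.WordRepresentable) :
    G.SemiTransitive := by
  obtain ⟨w, hw⟩ := hG
  -- The counts alone do not separate letters that are missing from `w`; a well-order breaks ties.
  let R : V → V → Prop := fun i j => (∀ u, u <+: w → u.count j ≤ u.count i) ∧
    ((∀ u, u <+: w → u.count i ≤ u.count j) → WellOrderingRel i j)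
  have hirr : ∀ i, ¬ R i i := fun i h => irrefl_of WellOrderingRel i (h.2 fun _ _ => le_rfl)
  have htrans : ∀ i j k, R i j → R j k → R i k := fun i j k hij hjk =>
    ⟨fun u hu => (hjk.1 u hu).trans (hij.1 u hu), fun h =>
      trans_of WellOrderingRel (hij.2 fun u hu => (h u hu).trans (hjk.1 u hu))
        (hjk.2 fun u hu => (hij.1 u hu).trans (h u hu))⟩
  let D : Digraph V := ⟨fun i j => R i j ∧ Leads w i j⟩
  refine ⟨D, ⟨fun i j => ⟨fun h => ?_, ?_⟩, fun i j h h' => hirr i (htrans _ _ _ h.1 h'.1)⟩, ?_, ?_⟩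
  · have hne := h.ne
    rw [hw i j hne, alternate_iff_leads_or_leads hne] at h
    wlog hl : Leads w i j generalizing i j
    · exact (this j i h.symm hne.symm (h.resolve_left hl)).symm
    rcases trichotomous_of WellOrderingRel i j with hlt | heq | hgt
    · exact .inl ⟨⟨fun u hu => (hl u hu).1, fun _ => hlt⟩, hl⟩
    · exact absurd heq hne
    · by_cases hc : ∀ u, u <+: w → u.count i ≤ u.count j
      · exact .inr ⟨⟨hc, fun _ => hgt⟩, fun u hu => ⟨hc u hu, by have := (hl u hu).1; omega⟩⟩
      · exact .inl ⟨⟨fun u hu => (hl u hu).1, fun h' => absurd h' hc⟩, hl⟩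
  · intro h
    have hne : i ≠ j := by
      rintro rfl
      rcases h with h | h <;> exact hirr _ h.1
    rw [hw i j hne, alternate_iff_leads_or_leads hne]
    exact h.imp (fun h => h.2) (fun h => h.2)
  · intro v hv
    have hle : ∀ a b, Relation.TransGen D.Adj a b → R a b := by
      intro a b h
      induction h with
      | single h => exact h.1
      | tail _ h ih => exact htrans _ _ _ ih h.1
    exact hirr v (hle v v hv)
  · intro p hp hc hends
    have : IsTrans V R := ⟨htrans⟩
    have hR : p.Pairwise R := List.isChain_iff_pairwise.1 (hc.imp fun _ _ h => h.1)
    have hfirst : ∀ a ∈ p, ∀ u, u <+: w → u.count a ≤ u.count (p.head hp) := by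
      intro a ha u hu
      obtain ⟨b, l, rfl⟩ := List.exists_cons_of_ne_nil hp
      rcases List.mem_cons.1 ha with rfl | ha
      · exact le_rfl
      · exact ((List.pairwise_cons.1 hR).1 a ha).1 u hu
    have hlast : ∀ a ∈ p, ∀ u, u <+: w → u.count (p.getLast hp) ≤ u.count a := by
      intro a ha u hu
      obtain ⟨l, b, rfl⟩ := List.eq_nil_or_concat' p |>.resolve_left hp
      rw [List.getLast_append_singleton]
      rcases List.mem_append.1 ha with ha | ha
      · exact ((List.pairwise_append.1 hR).2.2 a ha b (by simp)).1 u hu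
      · simp [List.mem_singleton.1 ha]
    refine hR.imp_of_mem fun {a b} ha hb h => ⟨h, fun u hu => ⟨h.1 u hu, ?_⟩⟩
    exact (hfirst a ha u hu).trans ((hends.2 u hu).2.trans
      (Nat.succ_le_succ (hlast b hb u hu)))

/-! ### Paths in semi-transitive orientations -/

/-- In a semi-transitive digraph, a vertex on a directed path from `a` to `b` is joined to both
ends as soon as `a → b` is an arc. -/
theorem SemiTransitiveDigraph.adj_of_transGen {D : Digraph V} (hD : SemiTransitiveDigraph D)
    {a m b : V} (ham : Relation.TransGen D.Adj a m) (hmb : Relation.TransGen D.Adj m b)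
    (hab : D.Adj a b) : D.Adj a m ∧ D.Adj m b := by
  obtain ⟨c, hac, hcm⟩ := Relation.TransGen.head'_iff.1 ham
  obtain ⟨d, hmd, hdb⟩ := Relation.TransGen.head'_iff.1 hmb
  obtain ⟨l₁, hl₁, hlast₁⟩ := List.exists_isChain_cons_of_relationReflTransGen hcm
  obtain ⟨l₂, hl₂, hlast₂⟩ := List.exists_isChain_cons_of_relationReflTransGen hdb
  have hchain : (a :: ((c :: l₁) ++ (d :: l₂))).IsChain D.Adj := by
    refine List.IsChain.cons_cons hac (hl₁.append hl₂ ?_)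
    intro x hx y hy
    rw [List.getLast?_eq_some_getLast (List.cons_ne_nil c l₁), hlast₁] at hx
    simp only [Option.mem_def, Option.some.injEq, List.head?_cons] at hx hy
    subst hx hy
    exact hmd
  have hlast : (a :: ((c :: l₁) ++ (d :: l₂))).getLast (by simp) = b := by
    simpa using hlast₂
  have hp := hD.2 _ (by simp) hchain (by rw [hlast]; exact hab)
  have hm : m ∈ c :: l₁ := hlast₁ ▸ List.getLast_mem _
  have hb : b ∈ d :: l₂ := hlast₂ ▸ List.getLast_mem _
  rw [List.pairwise_cons, List.pairwise_append] at hp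
  exact ⟨hp.1 m (List.mem_append_left _ hm), hp.2.2.2 m hm b hb⟩

theorem DirectedAcyclic.exists_topologicalSort [Finite V] {D : Digraph V}
    (hD : DirectedAcyclic D) :
    ∃ L : List V, L.Nodup ∧ (∀ v, v ∈ L) ∧ L.Pairwise fun a b => ¬ D.Adj b a := by
  classical
  have := Fintype.ofFinite V
  have : IsPartialOrder V (Relation.ReflTransGen D.Adj) :=
    { refl := fun _ => .refl
      trans := fun _ _ _ => .trans
      antisymm := fun a b hab hba => by
        rcases Relation.reflTransGen_iff_eq_or_transGen.1 hab with h | h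
        · exact h.symm
        · exact absurd (h.trans_left hba) (hD a) }
  obtain ⟨s, hs, hle⟩ := extend_partialOrder (Relation.ReflTransGen D.Adj)
  refine ⟨Finset.univ.sort s, Finset.sort_nodup _ _, by simp, ?_⟩
  refine ((Finset.pairwise_sort _ s).and (Finset.sort_nodup _ s)).imp fun {a b} h hba => ?_
  exact h.2 (antisymm_of s h.1 (hle _ _ (.single hba)))

/-! ### Semi-transitive graphs are word-representable -/

/-- The possible positions of a vertex of an acyclic digraph relative to a fixed vertex `v`: it is
`v` itself, an in- or out-neighbour of `v`, another ancestor or descendant of `v`, or none of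
these. -/
inductive Position
  | self | nearIn | farIn | nearOut | farOut | unrelated
  deriving DecidableEq

open Position

open Classical in
/-- The position of `u` relative to `v` in the digraph `D`. -/
noncomputable def position (D : Digraph V) (v u : V) : Position :=
  if u = v then self
  else if D.Adj u v then nearIn
  else if D.Adj v u then nearOut
  else if Relation.TransGen D.Adj u v then farIn
  else if Relation.TransGen D.Adj v u then farOut
  else unrelated

theorem position_spec (D : Digraph V) (v u : V) :
    match position D v u with
    | self => u = v
    | nearIn => D.Adj u v
    | nearOut => D.Adj v u
    | farIn => Relation.TransGen D.Adj u v ∧ ¬ D.Adj u v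
    | farOut => Relation.TransGen D.Adj v u ∧ ¬ D.Adj v u
    | unrelated => u ≠ v ∧ ¬ Relation.TransGen D.Adj u v ∧ ¬ Relation.TransGen D.Adj v u := by
  unfold position
  split_ifs <;> simp_all

/-- The order in which the classes of vertices relative to `v` are written in `separatingWord`.
Each class is written twice. The classes that alternate with `self` are exactly `nearIn` and
`nearOut`, and two classes that fail to alternate have no arc between them. -/
def separatingPattern : List Position :=
  [farIn, nearIn, unrelated, farIn, self, nearOut, nearIn, self, farOut, unrelated, nearOut, farOut]

/-- A word in which each vertex occurs twice, the ends of every arc `i → j` of a semi-transitive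
digraph form the subword `ijij`, and `v` alternates only with its neighbours. The list `L` is a
topological sort of the vertices. -/
noncomputable def separatingWord (D : Digraph V) (L : List V) (v : V) : List V :=
  separatingPattern.flatMap fun c => L.filter fun u => position D v u = c

theorem wordRestrict_flatMap {ι : Type*} (l : List ι) (f : ι → List V) (i j : V) :
    wordRestrict (l.flatMap f) i j = l.flatMap fun a => wordRestrict (f a) i j := by
  simp [wordRestrict, List.filter_flatMap]

theorem wordRestrict_separatingWord (D : Digraph V) (L : List V) (v i j : V) :
    wordRestrict (separatingWord D L v) i j =
      separatingPattern.flatMap fun c =>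
        (wordRestrict L i j).filter fun u => position D v u = c := by
  rw [separatingWord, wordRestrict_flatMap]
  simp only [wordRestrict, List.filter_filter, Bool.and_comm]

theorem wordRestrict_eq_or_eq {L : List V} (hnd : L.Nodup) (hmem : ∀ v, v ∈ L) {i j : V}
    (hij : i ≠ j) : wordRestrict L i j = [i, j] ∨ wordRestrict L i j = [j, i] := by
  refine List.perm_pair.1 ((List.perm_ext_iff_of_nodup (hnd.filter _) (by simpa using hij)).2 ?_)
  intro a
  simp [hmem]

theorem wordRestrict_eq_of_adj {D : Digraph V} {L : List V} (hnd : L.Nodup) (hmem : ∀ v, v ∈ L)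
    (hL : L.Pairwise fun a b => ¬ D.Adj b a) {i j : V} (hij : i ≠ j) (h : D.Adj i j) :
    wordRestrict L i j = [i, j] := by
  refine (wordRestrict_eq_or_eq hnd hmem hij).resolve_right fun h' => ?_
  have := (h' ▸ hL.filter _ : [j, i].Pairwise fun a b => ¬ D.Adj b a)
  simp [h] at this

theorem wordRestrict_separatingWord_of_adj {D : Digraph V} (hD : SemiTransitiveDigraph D)
    {L : List V} (hnd : L.Nodup) (hmem : ∀ v, v ∈ L) (hL : L.Pairwise fun a b => ¬ D.Adj b a)
    (v : V) {i j : V} (h : D.Adj i j) :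
    wordRestrict (separatingWord D L v) i j = [i, j, i, j] := by
  have hij : i ≠ j := by
    rintro rfl
    exact hD.1 i (.single h)
  rw [wordRestrict_separatingWord, wordRestrict_eq_of_adj hnd hmem hL hij h]
  have hpos : (separatingPattern.flatMap fun c => [i, j].filter fun u => position D v u = c) =
      separatingPattern.flatMap fun c =>
        (if position D v i = c then [i] else []) ++ (if position D v j = c then [j] else []) := by
    refine List.flatMap_congr fun c _ => ?_
    by_cases h₁ : position D v i = c <;> by_cases h₂ : position D v j = c <;> simp [h₁, h₂]
  rw [hpos]
  have hi := position_spec D v i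
  have hj := position_spec D v j
  have hacyc : ∀ {u}, Relation.TransGen D.Adj u v → ¬ Relation.TransGen D.Adj v u :=
    fun h₁ h₂ => hD.1 _ (h₁.trans h₂)
  have hin : Relation.TransGen D.Adj j v → Relation.TransGen D.Adj i v := .head h
  have hout : Relation.TransGen D.Adj v i → Relation.TransGen D.Adj v j := fun h' => h'.tail h
  have hmid : Relation.TransGen D.Adj i v → Relation.TransGen D.Adj v j →
      D.Adj i v ∧ D.Adj v j := fun h₁ h₂ => hD.adj_of_transGen h₁ h₂ h
  have hnearIn : D.Adj i v → Relation.TransGen D.Adj j v → D.Adj j v :=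
    fun h₁ h₂ => (hD.adj_of_transGen (.single h) h₂ h₁).2
  have hnearOut : D.Adj v j → Relation.TransGen D.Adj v i → D.Adj v i :=
    fun h₁ h₂ => (hD.adj_of_transGen h₂ (.single h) h₁).1
  have hirr : ¬ Relation.TransGen D.Adj v v := hD.1 v
  have hsingle : ∀ {a b}, D.Adj a b → Relation.TransGen D.Adj a b := .single
  clear hpos hmem hL hnd hD
  -- The pairs of classes that the pattern does not arrange as `ijij` are impossible for an arc.
  generalize position D v i = p at hi ⊢
  generalize position D v j = q at hj ⊢
  cases p <;> cases q <;>
    first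
    | (simp [separatingPattern]; done)
    | (exfalso; simp only at hi hj; grind)

theorem not_alternate_separatingWord {D : Digraph V}
    {L : List V} (hnd : L.Nodup) (hmem : ∀ v, v ∈ L) {v u : V} (huv : u ≠ v)
    (h₁ : ¬ D.Adj u v) (h₂ : ¬ D.Adj v u) :
    ¬ Alternate (separatingWord D L v) v u := by
  rw [alternate_iff_isChain, wordRestrict_separatingWord]
  have hv : position D v v = self := by simp [position]
  have hu : position D v u = farIn ∨ position D v u = farOut ∨ position D v u = unrelated := by
    unfold position
    split_ifs <;> simp_all
  rcases wordRestrict_eq_or_eq hnd hmem huv.symm with h | h <;> rw [h] <;>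
    rcases hu with hu | hu | hu <;> simp [separatingPattern, hv, hu, List.filter_cons]

theorem SemiTransitive.wordRepresentable [Finite V] {G : SimpleGraph V} (hG : G.SemiTransitive) :
    G.WordRepresentable := by
  obtain ⟨D, hDG, hD⟩ := hG
  obtain ⟨L, hnd, hmem, hL⟩ := hD.1.exists_topologicalSort
  refine ⟨L.flatMap (separatingWord D L), fun i j hij => ⟨fun h => ?_, fun h => ?_⟩⟩
  · have main : ∀ i j, i ≠ j → D.Adj i j → Alternate (L.flatMap (separatingWord D L)) i j := by
      intro i j hij h
      rw [alternate_iff_isChain, wordRestrict_flatMap,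
        List.flatMap_congr fun v _ => wordRestrict_separatingWord_of_adj hD hnd hmem hL v h]
      -- A leading `j` makes the claim inductive: each factor `ijij` is again preceded by `j`.
      suffices ∀ l : List V, (j :: l.flatMap fun _ => [i, j, i, j]).IsChain (· ≠ ·) from
        (this L).tail
      intro l
      induction l with
      | nil => simp
      | cons a l ih => simpa [hij, hij.symm] using ih
    rcases (hDG.adj_iff i j).1 h with h | h
    · exact main i j hij h
    · have := main j i hij.symm h
      rwa [alternate_iff_isChain, wordRestrict_comm, ← alternate_iff_isChain] at this
  · by_contra hn
    rw [hDG.adj_iff, not_or] at hn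
    refine not_alternate_separatingWord hnd hmem hij.symm hn.2 hn.1 ?_
    rw [alternate_iff_isChain] at h ⊢
    rw [wordRestrict_flatMap] at h
    exact h.infix (List.infix_flatMap_of_mem (hmem i)
      fun v => wordRestrict (separatingWord D L v) i j)

/-! ### Induced subgraphs -/

theorem IsOrientationOf.comap {D : Digraph W} {G : SimpleGraph V} {H : SimpleGraph W}
    (hD : IsOrientationOf D H) (f : G ↪g H) :
    IsOrientationOf ⟨fun a b => D.Adj (f a) (f b)⟩ G :=
  ⟨fun u v => by rw [← f.map_adj_iff, hD.adj_iff], fun _ _ => hD.asymm _ _⟩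

theorem IsComparabilityGraph.of_embedding {G : SimpleGraph V} {H : SimpleGraph W}
    (hH : H.IsComparabilityGraph) (f : G ↪g H) : G.IsComparabilityGraph := by
  obtain ⟨D, hD, ht⟩ := hH
  exact ⟨_, hD.comap f, fun _ _ _ => ht _ _ _⟩

theorem SemiTransitive.of_embedding {G : SimpleGraph V} {H : SimpleGraph W}
    (hH : H.SemiTransitive) (f : G ↪g H) : G.SemiTransitive := by
  obtain ⟨D, hD, hac, hs⟩ := hH
  refine ⟨_, hD.comap f, fun v hv => hac (f v) (hv.lift f fun _ _ h => h), fun p hp hc h => ?_⟩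
  have := hs (p.map f) (by simpa using hp) ((List.isChain_map f).2 hc) (by simpa using h)
  rwa [List.pairwise_map] at this

/-! ### Graphs with a universal vertex -/

/-- If `x` is adjacent to all of `H`, then a semi-transitive orientation of the ambient graph yields
a transitive one of `H`: it is transitive on the in-neighbours and on the out-neighbours of `x`, all
arcs between the two classes leave the in-neighbours, and these arcs are reversed. -/
theorem SemiTransitive.isComparabilityGraph {G : SimpleGraph V} {H : SimpleGraph W}
    (hG : G.SemiTransitive) (f : H ↪g G) {x : V} (hx : ∀ y, G.Adj x (f y)) :
    H.IsComparabilityGraph := by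
  obtain ⟨D, hDG, hD⟩ := hG
  have hside : ∀ y, D.Adj x (f y) ∨ D.Adj (f y) x := fun y => (hDG.adj_iff _ _).1 (hx y)
  have hor := hDG.comap f
  have htri : ∀ {a m b}, D.Adj a m → D.Adj m b → ¬ D.Adj b a := fun h₁ h₂ h₃ =>
    hD.1 _ ((Relation.TransGen.single h₁).tail h₂ |>.tail h₃)
  -- Directed paths with three arcs: a chord joining the ends forces all other chords.
  have hquad : ∀ {a b c d}, D.Adj a b → D.Adj b c → D.Adj c d → D.Adj a d →
      D.Adj a c ∧ D.Adj b d := fun h₁ h₂ h₃ h₄ =>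
    ⟨(hD.adj_of_transGen (.tail (.single h₁) h₂) (.single h₃) h₄).1,
      (hD.adj_of_transGen (.single h₁) (.tail (.single h₂) h₃) h₄).2⟩
  let In : W → Prop := fun y => D.Adj (f y) x
  have hout : ∀ {y}, ¬ In y → D.Adj x (f y) := fun {y} h => (hside y).resolve_right h
  -- An arc into an in-neighbour of `x` starts at an in-neighbour of `x`.
  have hback : ∀ {a b}, D.Adj (f a) (f b) → In b → In a := fun {a b} h hb => by
    by_contra ha
    exact htri (hout ha) h hb
  refine ⟨⟨fun a b => ((In a ↔ In b) ∧ D.Adj (f a) (f b)) ∨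
    (¬ In a ∧ In b ∧ D.Adj (f b) (f a))⟩, ⟨fun a b => ?_, fun a b => ?_⟩, fun a b c => ?_⟩
  · have h₁ := hor.adj_iff a b
    have h₂ := @hback a b
    have h₃ := @hback b a
    simp only at h₁ ⊢
    tauto
  · have h₁ := hor.asymm a b
    simp only at h₁ ⊢
    tauto
  · rintro (⟨hab, h₁⟩ | ⟨ha, hb, h₁⟩) (⟨hbc, h₂⟩ | ⟨hb', hc, h₂⟩)
    · refine .inl ⟨hab.trans hbc, ?_⟩
      by_cases ha : In a
      · exact (hquad h₁ h₂ (hbc.1 (hab.1 ha)) ha).1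
      · exact (hquad (hout ha) h₁ h₂ (hout (hab.trans hbc |>.not.1 ha))).2
    · have ha : ¬ In a := hab.not.2 hb'
      exact .inr ⟨ha, hc, (hquad hc (hout ha) h₁ h₂).1⟩
    · have hc := hbc.1 hb
      exact .inr ⟨ha, hc, (hquad h₂ hc (hout ha) h₁).2⟩
    · exact absurd hb hb'

/-- A transitive orientation of `G - x`, together with all arcs from `x`, is a transitive and hence
semi-transitive orientation of `G`. -/
theorem IsComparabilityGraph.semiTransitive_of_universal {G : SimpleGraph V} {x : V}
    (hx : ∀ y, y ≠ x → G.Adj x y) (hH : (G.induce {v | v ≠ x}).IsComparabilityGraph) :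
    G.SemiTransitive := by
  obtain ⟨D, hD, ht⟩ := hH
  let E : Digraph V := ⟨fun a b => (a = x ∧ b ≠ x) ∨
    ∃ (ha : a ≠ x) (hb : b ≠ x), D.Adj ⟨a, ha⟩ ⟨b, hb⟩⟩
  have hasymm : ∀ a b, E.Adj a b → ¬ E.Adj b a := by
    rintro a b (⟨ha, hb⟩ | ⟨ha, hb, h⟩) (⟨hb', ha'⟩ | ⟨hb', ha', h'⟩)
    · exact hb hb'
    · exact ha' ha
    · exact hb hb'
    · exact hD.asymm _ _ h h'
  have htrans : ∀ a b c, E.Adj a b → E.Adj b c → E.Adj a c := by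
    rintro a b c (⟨ha, hb⟩ | ⟨ha, hb, h⟩) (⟨hb', hc⟩ | ⟨hb', hc, h'⟩)
    · exact absurd hb' hb
    · exact .inl ⟨ha, hc⟩
    · exact absurd hb' hb
    · exact .inr ⟨ha, hc, ht _ _ _ h h'⟩
  have : IsTrans V E.Adj := ⟨htrans⟩
  refine ⟨E, ⟨fun a b => ?_, hasymm⟩, fun v hv => ?_, fun p _ hc _ => List.isChain_iff_pairwise.1 hc⟩
  · by_cases ha : a = x <;> by_cases hb : b = x
    · simp [E, ha, hb]
    · simpa [E, ha, hb] using hx b hb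
    · simpa [E, ha, hb] using (hx a ha).symm
    · simpa [E, ha, hb] using hD.adj_iff ⟨a, ha⟩ ⟨b, hb⟩
  · rw [Relation.transGen_eq_self] at hv
    exact hasymm v v hv hv

end SimpleGraph

open SimpleGraph in
theorem mainTheorem2 {V : Type*} [Finite V] (G : SimpleGraph V) (x : V)
    (hx : ∀ y : V, y ≠ x → G.Adj x y) :
    G.IsMinimalNonWordRepresentable ↔
      (G.induce {v : V | v ≠ x}).IsMinimalNonComparability ∧
        (G.induce {v : V | v ≠ x}).SemiTransitive := by
  constructor
  · rintro ⟨hG, hmin⟩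
    refine ⟨⟨fun h => hG (h.semiTransitive_of_universal hx).wordRepresentable, fun S hS => ?_⟩,
      (hmin _ ((Set.ne_univ_iff_exists_notMem _).2 ⟨x, by simp⟩)).semiTransitive⟩
    -- Adding `x` to the proper subset `S` of `G - x` gives a proper subset of `G`.
    let T : Set V := insert x (Subtype.val '' S)
    have hT : T ≠ Set.univ := by
      obtain ⟨y, hy⟩ := (Set.ne_univ_iff_exists_notMem S).1 hS
      refine (Set.ne_univ_iff_exists_notMem T).2 ⟨y.1, ?_⟩
      rintro (h | ⟨z, hz, h⟩)
      · exact y.2 h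
      · exact hy (Subtype.ext h ▸ hz)
    let f : (G.induce {v : V | v ≠ x}).induce S ↪g G.induce T :=
      { toFun := fun y => ⟨y.1.1, .inr ⟨y.1, y.2, rfl⟩⟩
        inj' := fun a b h => Subtype.ext (Subtype.ext (Subtype.mk.inj h))
        map_rel_iff' := Iff.rfl }
    exact (hmin T hT).semiTransitive.isComparabilityGraph f (x := ⟨x, .inl rfl⟩)
      fun y => hx _ y.1.2
  · rintro ⟨⟨hH, hmin⟩, hst⟩
    refine ⟨fun h => hH (h.semiTransitive.isComparabilityGraph
      (SimpleGraph.Embedding.induce _) (x := x) fun y => hx _ y.2), fun S hS => ?_⟩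
    apply SemiTransitive.wordRepresentable
    by_cases hxS : x ∈ S
    · refine IsComparabilityGraph.semiTransitive_of_universal (x := ⟨x, hxS⟩)
        (fun y hy => hx _ fun h => hy (Subtype.ext h)) ?_
      let T : Set {v : V | v ≠ x} := {y | y.1 ∈ S}
      have hT : T ≠ Set.univ := by
        obtain ⟨y, hy⟩ := (Set.ne_univ_iff_exists_notMem S).1 hS
        exact (Set.ne_univ_iff_exists_notMem T).2 ⟨⟨y, fun h => hy (h ▸ hxS)⟩, hy⟩
      let f : (G.induce S).induce {v | v ≠ ⟨x, hxS⟩} ↪g (G.induce {v : V | v ≠ x}).induce T :=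
        { toFun := fun y => ⟨⟨y.1.1, fun h => y.2 (Subtype.ext h)⟩, y.1.2⟩
          inj' := fun a b h =>
            Subtype.ext (Subtype.ext (congrArg (fun z => z.1.1) h))
          map_rel_iff' := Iff.rfl }
      exact (hmin T hT).of_embedding f
    · let f : G.induce S ↪g G.induce {v : V | v ≠ x} :=
        { toFun := fun y => ⟨y.1, fun h => hxS (h ▸ y.2)⟩
          inj' := fun a b h => Subtype.ext (by simpa using h)
          map_rel_iff' := Iff.rfl }
      exact hst.of_embedding f
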